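/- **Setting.** Let $n=(n_1,\dots,n_r)$ with all $n_i\ge 1$. A permutation set for $n$ is a family $\theta=\{\theta_{ij}:1\le i<j\le r\}$, where $\theta_{ij}$ is a permutation of the formal products $\{e_{ip}e_{jq}:1\le p\le n_i,\ 1\le q\le n_j\}$. Let $\mathbb F^+_\theta$ be the unital semigroup generated by the $e_{ip}$ ($1\le i\le r$, $1\le p\le n_i$) subject only to the relations $e_{ip}e_{jq}=e_{jq'}e_{ip'}$ for $i<j$ and $\theta_{ij}(e_{ip}e_{jq})=e_{ip'}e_{jq'}$. Call $\theta$ cancelative if $\mathbb F^+_\theta$ is left and right cancelative. In that case let $L_v$, $v\in\mathbb F^+_\theta$, be the isometries $L_v\xi_w=\xi_{vw}$ on the Fock space $\mathcal H_\theta=\ell^2(\mathbb F^+_\theta)$ with orthonormal basis $\{\xi_w\}$, let $\mathcal A_\theta$ be the norm closed algebra generated by $\{L_w:w\in\mathbb F^+_\theta\}$, and let $\mathcal I_\theta=\{X\in\mathcal A_\theta:\langle X\xi_1,\xi_1\rangle=0\}$ be the ideal of operators with vanishing constant term, where $1$ is the unit of $\mathbb F^+_\theta$. For $j<i$, let $\theta_{ij}$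 denote the permutation of the formal products $e_{ip}e_{jq}$ that describes the same relations with the two sets of generators taken in the other order; that is, $\theta_{ij}(e_{ip}e_{jq})=e_{ip'}e_{jq'}$ if and only if $\theta_{ji}(e_{jq'}e_{ip'})=e_{jq}e_{ip}$. Write $\pi(\theta_{ij})$ for the permutation matrix of $\theta_{ij}$. **Theorem 7.2.** Let $\theta$ and $\tau$ be cancelative permutation sets for $n=(n_1,\dots,n_r)$ and $m=(m_1,\dots,m_s)$, with all $n_i,m_j\ge1$. Let $\Phi:\mathcal A_\theta\to\mathcal A_\tau$ be an isometric isomorphism of complex algebras with $\Phi(\mathcal I_\theta)=\mathcal I_\tau$. Then $r=s$ and there are a bijection $\sigma:\{1,\dots,r\}\to\{1,\dots,s\}$ with $n_i=m_{\sigma(i)}$ for all $i$ and unitary matrices $A_i=(a^{(i)}_{pq})\in M_{n_i}(\mathbb C)$ such that: 1. ($\Phi$ is multi-graded) $\Phi(L_{e_{ip}})=\sum_{q}a^{(i)}_{pq}L_{e_{\sigma(i)q}}$ for all $1\le i\le r$ and $1\le p\le n_i$; 2. ($\Phi$ is unitarily implemented) $\Phi(X)=UXU^*$ for all $X\in\mathcal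 A_\theta$, where $U:\mathcal H_\theta\to\mathcal H_\tau$ is a unitary operator equal to $U_{A_1,\dots,A_r}$, that is, for every word $e_{i_1p_1}\cdots e_{i_kp_k}$ in the generators, $$U\,\xi_{e_{i_1p_1}\cdots e_{i_kp_k}}=\sum_{q_1,\dots,q_k}a^{(i_1)}_{p_1q_1}\cdots a^{(i_k)}_{p_kq_k}\ \xi_{e_{\sigma(i_1)q_1}\cdots e_{\sigma(i_k)q_k}};$$ 3. ($\theta$ and $\tau$ are product unitarily equivalent, after the relabelling $\sigma$) $\pi(\theta_{ij})=(A_i\otimes A_j)\,\pi(\tau_{\sigma(i)\sigma(j)})\,(A_i\otimes A_j)^*$ for all $1\le i<j\le r$. -/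

import Mathlib

open scoped Kronecker InnerProductSpace

noncomputable section

namespace HigherRank

/-- A permutation set for the tuple `n = (n_1, …, n_r)`: for all `i < j` a permutation of the
formal products `e_{ip} e_{jq}`, encoded as the pairs `(p, q)`. -/
structure PermSet {r : ℕ} (n : Fin r → ℕ) where
  perm : ∀ i j : Fin r, i < j → Equiv.Perm (Fin (n i) × Fin (n j))

/-- The generators `e_{ip}`, with `1 ≤ i ≤ r` and `1 ≤ p ≤ n_i`. -/
abbrev Gen {r : ℕ} (n : Fin r → ℕ) : Type := Σ i : Fin r, Fin (n i)

namespace PermSet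

variable {r : ℕ} {n : Fin r → ℕ} (θ : PermSet n)

/-- The commutation relations `e_{ip} e_{jq} = e_{jq'} e_{ip'}`, where `i < j` and
`θ_{ij}(p, q) = (p', q')`. -/
inductive Rel : FreeMonoid (Gen n) → FreeMonoid (Gen n) → Prop
  | comm (i j : Fin r) (h : i < j) (p : Fin (n i)) (q : Fin (n j)) :
      Rel (FreeMonoid.of ⟨i, p⟩ * FreeMonoid.of ⟨j, q⟩)
        (FreeMonoid.of ⟨j, (θ.perm i j h (p, q)).2⟩ *
          FreeMonoid.of ⟨i, (θ.perm i j h (p, q)).1⟩)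

/-- The unital semigroup `𝔽⁺_θ`: the universal monoid on the generators `e_{ip}` subject to the
commutation relations of `θ`. -/
abbrev Semi : Type := PresentedMonoid θ.Rel

/-- The generator `e_{ip}` as an element of `𝔽⁺_θ`. -/
def gen (g : Gen n) : θ.Semi := PresentedMonoid.of θ.Rel g

/-- The permutation of the formal products `e_{ip} e_{jq}` for an arbitrary pair of indices: if
`i < j` it is `θ_{ij}`, and if `j < i` it is the one that describes the same relations with the
two sets of generators listed in the other order: the relation `e_{jq} e_{ip} = e_{ip'} e_{jq'}`
with `θ_{ji}(q, p) = (q', p')` is read as the rule `(p', q') ↦ (p, q)`.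
(The value for `i = j` is irrelevant.) -/
def relPerm (i j : Fin r) : Equiv.Perm (Fin (n i) × Fin (n j)) :=
  if h : i < j then θ.perm i j h
  else if h : j < i then
    ((Equiv.prodComm (Fin (n i)) (Fin (n j))).trans (θ.perm j i h).symm).trans
      (Equiv.prodComm (Fin (n j)) (Fin (n i)))
  else 1

/-- The Fock space `ℓ²(𝔽⁺_θ)`. -/
abbrev Fock : Type := lp (fun _ : θ.Semi => ℂ) 2

open Classical in
/-- The basis vector `ξ_w` of the Fock space. -/
def xi (w : θ.Semi) : θ.Fock := lp.single 2 w (1 : ℂ)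

theorem orthonormal_xi : Orthonormal ℂ θ.xi := by
  classical
  rw [orthonormal_iff_ite]
  intro v w
  unfold xi
  rw [lp.inner_single_left]
  by_cases h : v = w
  · subst h; simp
  · simp [h]

variable [IsCancelMul θ.Semi]

theorem orthonormal_xi_mul (v : θ.Semi) : Orthonormal ℂ (fun w => θ.xi (v * w)) :=
  θ.orthonormal_xi.comp _ (mul_right_injective v)

/-- The left shift isometry `L_v` on the Fock space, the continuous linear operator with
`L_v ξ_w = ξ_{vw}` for all `w` (see `shift_xi`). -/
def shift (v : θ.Semi) : θ.Fock →L[ℂ] θ.Fock :=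
  (θ.orthonormal_xi_mul v).orthogonalFamily.linearIsometry.toContinuousLinearMap

theorem shift_xi (v w : θ.Semi) : θ.shift v (θ.xi w) = θ.xi (v * w) := by
  classical
  have := (θ.orthonormal_xi_mul v).orthogonalFamily.linearIsometry_apply_single (i := w) (1 : ℂ)
  simp [shift, xi] at this ⊢

/-- The norm closed analytic Toeplitz algebra `𝒜_θ`: the norm closed algebra of operators on the
Fock space generated by the shifts `L_w`, `w ∈ 𝔽⁺_θ` (it is unital, as `L_1 = 1`). -/
def toeplitz : Subalgebra ℂ (θ.Fock →L[ℂ] θ.Fock) :=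
  (Algebra.adjoin ℂ (Set.range θ.shift)).topologicalClosure

theorem shift_mem_toeplitz (v : θ.Semi) : θ.shift v ∈ θ.toeplitz :=
  Subalgebra.le_topologicalClosure _ (Algebra.subset_adjoin ⟨v, rfl⟩)

/-- The shift `L_v` as an element of `𝒜_θ`. -/
def shiftA (v : θ.Semi) : θ.toeplitz := ⟨θ.shift v, θ.shift_mem_toeplitz v⟩

/-- The ideal `ℐ_θ` of the operators `X ∈ 𝒜_θ` with vanishing constant term `⟨X ξ_1, ξ_1⟩`. -/
def zeroConst : Set θ.toeplitz :=
  {X | ⟪θ.xi 1, (X : θ.Fock →L[ℂ] θ.Fock) (θ.xi 1)⟫_ℂ = 0}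

end PermSet

section Equivalence

variable {r s : ℕ} {n : Fin r → ℕ} {m : Fin s → ℕ}

/-- A family of complex matrices `A_i`, of format `n_i × m_{σ(i)}`, for a relabelling `σ` of the
sets of generators. -/
abbrev MatFamily (n : Fin r → ℕ) (m : Fin s → ℕ) (σ : Fin r ≃ Fin s) : Type :=
  ∀ i : Fin r, Matrix (Fin (n i)) (Fin (m (σ i))) ℂ

/-- All the matrices `A_i` are unitary (in particular square, see the equalities `n_i = m_{σ(i)}`
that go with it). -/
def MatFamily.IsUnitary {σ : Fin r ≃ Fin s} (A : MatFamily n m σ) : Prop :=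
  ∀ i, A i * (A i).conjTranspose = 1 ∧ (A i).conjTranspose * A i = 1

/-- The permutation matrices `π(θ_{ij})` and `π(τ_{σ(i)σ(j)})` satisfy
`π(θ_{ij}) = (A_i ⊗ A_j) π(τ_{σ(i)σ(j)}) (A_i ⊗ A_j)^*` for all `i < j`. -/
def Intertwines (θ : PermSet n) (τ : PermSet m) (σ : Fin r ≃ Fin s) (A : MatFamily n m σ) :
    Prop :=
  ∀ i j, i < j →
    (θ.relPerm i j).permMatrix ℂ =
      (A i ⊗ₖ A j) * (τ.relPerm (σ i) (σ j)).permMatrix ℂ * (A i ⊗ₖ A j).conjTranspose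

/-- The operator `L_{A e_{ip}} = ∑_q (A_i)_{pq} L_{e_{σ(i) q}}` in `𝒜_τ`. -/
def genImage (τ : PermSet m) [IsCancelMul τ.Semi] (σ : Fin r ≃ Fin s) (A : MatFamily n m σ)
    (g : Gen n) : τ.toeplitz :=
  ∑ q : Fin (m (σ g.1)), A g.1 g.2 q • τ.shiftA (τ.gen ⟨σ g.1, q⟩)

/-- `U` is the operator `U_{A_1,…,A_r} = ∑_p A_1^{⊗ p_1} ⊗ ⋯ ⊗ A_r^{⊗ p_r}` between the Fock
spaces: it takes the basis vector of a word in the generators to the vector obtained by replacing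
each letter `e_{ip}` by the linear combination `∑_q (A_i)_{pq} e_{σ(i) q}` and expanding. -/
def IsTensorUnitary (θ : PermSet n) (τ : PermSet m) [IsCancelMul τ.Semi]
    (σ : Fin r ≃ Fin s) (A : MatFamily n m σ) (U : θ.Fock ≃ₗᵢ[ℂ] τ.Fock) : Prop :=
  ∀ l : List (Gen n),
    U (θ.xi (l.map θ.gen).prod) =
      ((l.map (genImage τ σ A)).prod : τ.Fock →L[ℂ] τ.Fock) (τ.xi 1)

end Equivalence

end HigherRank

end

open HigherRank

/-! Everything rests on rigidity of `Φ` in each total degree. Preserving the ideal of operators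
without constant term, `Φ` preserves the filtration by total degree (`map_mem_filt`), so modulo
higher degree it acts in degree `k` by a finite matrix whose inverse is the one of `Φ.symm`. Both
have rows of norm at most one, because `‖Φ(L_w) ξ_1‖ ≤ ‖L_w‖ ≤ 1`, and a trace computation then
makes them unitary (`levelMatrix_symm`). A row of norm exactly one leaves no room for coefficients
of other degrees, so `Φ` is graded (`vac_map_shiftA_eq_zero`), and `ξ_w ↦ Φ(L_w) ξ_1` extends to a
unitary implementing `Φ`.

Colours are separated by characters. A character of `𝔽⁺_τ` living on one colour, with a unit vector
of values, has square norm at least one on every level. Its pullback along `Φ` has the same level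
norms, hence is not square summable. But a character of norm less than one on each colour is square
summable, as elements factor into one word per colour and geometric series converge. So the pullback
has norm at least one on some colour, and the total in degree one leaves nothing for the others. A
vector space over `ℂ` is not a finite union of proper subspaces, so this colour can be chosen
independently of the vector (`exists_color`); applying this to `Φ` and `Φ.symm` gives `σ`. Comparing
coefficients in the images of the commutation relations yields the matrix identity. -/

noncomputable section

namespace HigherRank

namespace PermSet

/-! ### The semigroup: degree, products of two generators, growth and characters -/

section Semigroup

variable {r : ℕ} {n : Fin r → ℕ} (θ : PermSet n)

theorem gen_mul_gen_of_lt {i j : Fin r} (h : i < j) (p : Fin (n i)) (q : Fin (n j)) :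
    θ.gen ⟨i, p⟩ * θ.gen ⟨j, q⟩ =
      θ.gen ⟨j, (θ.perm i j h (p, q)).2⟩ * θ.gen ⟨i, (θ.perm i j h (p, q)).1⟩ :=
  PresentedMonoid.mk_eq_mk_of_rel (Rel.comm i j h p q)

/-- The commutation relations, for two colours in either order. -/
theorem gen_mul_gen {i j : Fin r} (h : i ≠ j) (p : Fin (n i)) (q : Fin (n j)) :
    θ.gen ⟨i, p⟩ * θ.gen ⟨j, q⟩ =
      θ.gen ⟨j, (θ.relPerm i j (p, q)).2⟩ * θ.gen ⟨i, (θ.relPerm i j (p, q)).1⟩ := by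
  rcases lt_or_gt_of_ne h with h | h
  · simp only [relPerm, h, dif_pos]
    exact θ.gen_mul_gen_of_lt h p q
  · have h' : ¬ i < j := h.not_gt
    simp only [relPerm, h, h', dif_pos, dif_neg, not_false_eq_true, Equiv.trans_apply,
      Equiv.prodComm_apply, Prod.swap]
    rw [θ.gen_mul_gen_of_lt h]
    simp

/-- The homomorphism out of `𝔽⁺_θ` given by images of the generators that satisfy the commutation
relations. -/
def liftHom {M : Type*} [Monoid M] (f : Gen n → M)
    (hf : ∀ (i j : Fin r) (h : i < j) (p : Fin (n i)) (q : Fin (n j)),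
      f ⟨i, p⟩ * f ⟨j, q⟩ =
        f ⟨j, (θ.perm i j h (p, q)).2⟩ * f ⟨i, (θ.perm i j h (p, q)).1⟩) : θ.Semi →* M :=
  PresentedMonoid.lift f (by
    rintro _ _ ⟨i, j, h, p, q⟩
    simpa using hf i j h p q)

@[simp]
theorem liftHom_gen {M : Type*} [Monoid M] (f : Gen n → M)
    (hf : ∀ (i j : Fin r) (h : i < j) (p : Fin (n i)) (q : Fin (n j)),
      f ⟨i, p⟩ * f ⟨j, q⟩ =
        f ⟨j, (θ.perm i j h (p, q)).2⟩ * f ⟨i, (θ.perm i j h (p, q)).1⟩) (g : Gen n) :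
    θ.liftHom f hf (θ.gen g) = f g :=
  PresentedMonoid.lift_of _ _

theorem exists_eq_prod (v : θ.Semi) : ∃ l : List (Gen n), v = (l.map θ.gen).prod := by
  induction v using PresentedMonoid.inductionOn with
  | h a =>
    refine ⟨a.toList, ?_⟩
    induction a using FreeMonoid.inductionOn' with
    | one => simp
    | of_mul x xs ih =>
      rw [map_mul, ih]
      simp [gen, PresentedMonoid.of]

theorem semi_induction {P : θ.Semi → Prop} (one : P 1)
    (gen_mul : ∀ g v, P v → P (θ.gen g * v)) (v : θ.Semi) : P v := by
  obtain ⟨l, rfl⟩ := θ.exists_eq_prod v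
  induction l with
  | nil => simpa using one
  | cons g l ih => simpa using gen_mul g _ ih

/-- The total degree of an element of `𝔽⁺_θ`, the length of the words that represent it. -/
def deg (v : θ.Semi) : ℕ :=
  Multiplicative.toAdd (θ.liftHom (fun _ => Multiplicative.ofAdd 1) (fun _ _ _ _ _ => rfl) v)

@[simp] theorem deg_one : θ.deg 1 = 0 := by simp [deg]

@[simp] theorem deg_gen (g : Gen n) : θ.deg (θ.gen g) = 1 := by simp [deg]

@[simp] theorem deg_mul (v w : θ.Semi) : θ.deg (v * w) = θ.deg v + θ.deg w := by simp [deg]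

theorem deg_prod (l : List (Gen n)) : θ.deg (l.map θ.gen).prod = l.length := by
  induction l with
  | nil => simp
  | cons g l ih => simp [ih, add_comm]

theorem finite_deg_eq (k : ℕ) : {v : θ.Semi | θ.deg v = k}.Finite := by
  refine ((List.finite_length_eq (Gen n) k).image fun l => (l.map θ.gen).prod).subset ?_
  intro v hv
  obtain ⟨l, rfl⟩ := θ.exists_eq_prod v
  exact ⟨l, by simpa [deg_prod] using hv, rfl⟩

/-- The elements of total degree `k`. -/
abbrev Level (k : ℕ) : Type := {v : θ.Semi // θ.deg v = k}

instance (k : ℕ) : Fintype (θ.Level k) := (θ.finite_deg_eq k).fintype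

instance (k : ℕ) : DecidableEq (θ.Level k) := Classical.decEq _

theorem eq_one_of_deg_eq_zero {v : θ.Semi} (h : θ.deg v = 0) : v = 1 := by
  obtain ⟨l, rfl⟩ := θ.exists_eq_prod v
  rw [deg_prod, List.length_eq_zero_iff] at h
  simp [h]

theorem exists_gen_of_deg_eq_one {v : θ.Semi} (h : θ.deg v = 1) : ∃ g, v = θ.gen g := by
  obtain ⟨l, rfl⟩ := θ.exists_eq_prod v
  rw [deg_prod, List.length_eq_one_iff] at h
  obtain ⟨g, rfl⟩ := h
  exact ⟨g, by simp⟩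

/-- The words of length at most two, modulo the commutation relations, with an absorbing element
for the longer words. -/
inductive ShortWord (n : Fin r → ℕ) : Type
  | nil : ShortWord n
  | single (g : Gen n) : ShortWord n
  | pair (g h : Gen n) : ShortWord n
  | long : ShortWord n

/-- The product of two generators, with distinct colours listed in increasing order. -/
def sortPair : Gen n → Gen n → ShortWord n
  | ⟨i, p⟩, ⟨j, q⟩ =>
    if h : j < i then .pair ⟨j, ((θ.perm j i h).symm (q, p)).1⟩ ⟨i, ((θ.perm j i h).symm (q, p)).2⟩
    else .pair ⟨i, p⟩ ⟨j, q⟩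

/-- Right multiplication of a short word by a generator. -/
def append (g : Gen n) : ShortWord n → ShortWord n
  | .nil => .single g
  | .single g' => θ.sortPair g' g
  | _ => .long

theorem append_single (g g' : Gen n) : θ.append g (.single g') = θ.sortPair g' g := rfl

theorem sortPair_rel {i j : Fin r} (h : i < j) (p : Fin (n i)) (q : Fin (n j)) :
    θ.sortPair ⟨i, p⟩ ⟨j, q⟩ =
      θ.sortPair ⟨j, (θ.perm i j h (p, q)).2⟩ ⟨i, (θ.perm i j h (p, q)).1⟩ := by
  simp [sortPair, h, h.not_gt]

theorem append_sortPair (g g₁ g₂ : Gen n) : θ.append g (θ.sortPair g₁ g₂) = .long := by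
  obtain ⟨i, p⟩ := g₁
  obtain ⟨j, q⟩ := g₂
  simp only [sortPair]
  split_ifs <;> rfl

/-- The action of `𝔽⁺_θ` on short words by right multiplication. -/
def appendHom : θ.Semi →* (Function.End (ShortWord n))ᵐᵒᵖ :=
  θ.liftHom (fun g => MulOpposite.op (θ.append g)) (by
    intro i j h p q
    apply MulOpposite.unop_injective
    funext x
    change θ.append _ (θ.append _ x) = θ.append _ (θ.append _ x)
    -- The relation is tested only on the empty word: two more letters absorb anything longer, so no
    -- compatibility among three colours is needed.
    cases x with
    | nil => exact θ.sortPair_rel h p q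
    | single g => rw [append_single, append_single, append_sortPair, append_sortPair]
    | pair g g' => rfl
    | long => rfl)

/-- The short word represented by an element of `𝔽⁺_θ`. -/
def shortWord (v : θ.Semi) : ShortWord n := (θ.appendHom v).unop .nil

theorem shortWord_gen (g : Gen n) : θ.shortWord (θ.gen g) = .single g := by
  rw [shortWord, appendHom, liftHom_gen]
  rfl

theorem shortWord_gen_mul_gen (g h : Gen n) :
    θ.shortWord (θ.gen g * θ.gen h) = θ.sortPair g h := by
  rw [shortWord, appendHom, map_mul, liftHom_gen, liftHom_gen]
  rfl

theorem gen_injective : Function.Injective θ.gen := by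
  intro g h e
  have := congrArg θ.shortWord e
  simpa [shortWord_gen] using this

theorem gen_mul_gen_injective (i j : Fin r) :
    Function.Injective fun x : Fin (n i) × Fin (n j) => θ.gen ⟨i, x.1⟩ * θ.gen ⟨j, x.2⟩ := by
  rintro ⟨p, q⟩ ⟨p', q'⟩ e
  have e := congrArg θ.shortWord e
  simp only [shortWord_gen_mul_gen, sortPair] at e
  split_ifs at e with h'
  · simp only [ShortWord.pair.injEq, Sigma.mk.injEq, heq_eq_eq, true_and] at e
    have e' := (θ.perm j i h').symm.injective (Prod.ext e.1 e.2)
    simp only [Prod.mk.injEq] at e' ⊢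
    exact e'.symm
  · simpa using e

/-- Generators of colour `j` are free. -/
def toFree (j : Fin r) : θ.Semi →* WithZero (FreeMonoid (Fin (n j))) :=
  θ.liftHom
    (fun g => if h : g.1 = j then ((FreeMonoid.of (h ▸ g.2) : FreeMonoid (Fin (n j))) : WithZero _)
      else 0) (by
    intro i k h p q
    -- A relation involves two distinct colours, so each side contains a letter sent to zero.
    by_cases hi : i = j
    · subst hi
      simp [h.ne']
    · simp [hi])

/-- The element of `𝔽⁺_θ` represented by a word of colour `j`. -/
def word (j : Fin r) (l : List (Fin (n j))) : θ.Semi := (l.map fun q => θ.gen ⟨j, q⟩).prod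

@[simp] theorem word_nil (j : Fin r) : θ.word j [] = 1 := rfl

@[simp] theorem word_cons (j : Fin r) (q : Fin (n j)) (l : List (Fin (n j))) :
    θ.word j (q :: l) = θ.gen ⟨j, q⟩ * θ.word j l := by simp [word]

theorem deg_word (j : Fin r) (l : List (Fin (n j))) : θ.deg (θ.word j l) = l.length := by
  induction l with
  | nil => simp
  | cons q l ih => simp [ih, add_comm]

theorem toFree_word (j : Fin r) (l : List (Fin (n j))) :
    θ.toFree j (θ.word j l) = (FreeMonoid.ofList l : WithZero (FreeMonoid (Fin (n j)))) := by
  induction l with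
  | nil => simp [FreeMonoid.ofList_nil]
  | cons q l ih =>
    rw [word_cons, map_mul, ih, FreeMonoid.ofList_cons, WithZero.coe_mul]
    simp [toFree]

theorem word_injective (j : Fin r) : Function.Injective (θ.word j) := by
  intro l l' e
  have := congrArg (θ.toFree j) e
  simp only [toFree_word, WithZero.coe_inj] at this
  exact FreeMonoid.ofList.injective this

/-- Commuting letters changes their indices but not their colours; this is what allows words to be
sorted by colour. -/
theorem exists_gen_mul_word {i j : Fin r} (h : i ≠ j) (p : Fin (n i)) (l : List (Fin (n j))) :
    ∃ l' p', θ.gen ⟨i, p⟩ * θ.word j l = θ.word j l' * θ.gen ⟨i, p'⟩ := by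
  induction l generalizing p with
  | nil => exact ⟨[], p, by simp⟩
  | cons q l ih =>
    obtain ⟨l', p', e⟩ := ih (θ.relPerm i j (p, q)).1
    refine ⟨(θ.relPerm i j (p, q)).2 :: l', p', ?_⟩
    rw [word_cons, word_cons, ← mul_assoc, θ.gen_mul_gen h, mul_assoc, e, mul_assoc]

/-- The elements that are products of words of single colours, with the colours in the given
order. -/
def colorSorted : List (Fin r) → Set θ.Semi
  | [] => {1}
  | i :: c => Set.image2 (fun l w => θ.word i l * w) Set.univ (colorSorted c)

theorem gen_mul_mem_colorSorted {c : List (Fin r)} {i : Fin r} (hi : i ∈ c) (p : Fin (n i))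
    {v : θ.Semi} (hv : v ∈ θ.colorSorted c) : θ.gen ⟨i, p⟩ * v ∈ θ.colorSorted c := by
  induction c generalizing p v with
  | nil => simp at hi
  | cons j c ih =>
    obtain ⟨l, -, w, hw, rfl⟩ := hv
    by_cases h : i = j
    · subst h
      exact ⟨p :: l, trivial, w, hw, by simp [mul_assoc]⟩
    · obtain ⟨l', p', e⟩ := θ.exists_gen_mul_word h p l
      refine ⟨l', trivial, θ.gen ⟨i, p'⟩ * w, ih ?_ p' hw, ?_⟩
      · simpa [h] using hi
      · simp only [← mul_assoc, e]

theorem one_mem_colorSorted (c : List (Fin r)) : (1 : θ.Semi) ∈ θ.colorSorted c := by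
  induction c with
  | nil => exact rfl
  | cons i c ih => exact ⟨[], trivial, 1, ih, by simp⟩

theorem mem_colorSorted_finRange (v : θ.Semi) : v ∈ θ.colorSorted (List.finRange r) := by
  induction v using θ.semi_induction with
  | one => exact θ.one_mem_colorSorted _
  | gen_mul g v hv => exact θ.gen_mul_mem_colorSorted (List.mem_finRange g.1) g.2 hv

open scoped ENNReal

/-- The sum over all words of the product of the weights of the letters is a geometric series. -/
theorem _root_.ENNReal.tsum_list_prod_map {α : Type*} [Fintype α] (f : α → ℝ≥0∞) :
    ∑' l : List α, (l.map f).prod = (1 - ∑ a, f a)⁻¹ := by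
  rw [← List.equivSigmaTuple.symm.tsum_eq, ENNReal.tsum_sigma', ← ENNReal.tsum_geometric]
  congr 1
  funext k
  rw [tsum_fintype, Fintype.sum_pow]
  refine Finset.sum_congr rfl fun x _ => ?_
  simp [List.equivSigmaTuple, List.map_ofFn, List.prod_ofFn]

/-- Sorted factorizations exhaust the elements, and each colour contributes a geometric series.
Uniqueness of the factorization is not needed, since overcounting only enlarges the bound. -/
theorem tsum_colorSorted_le (F : θ.Semi →* ℝ≥0∞) (c : List (Fin r)) :
    ∑' v : θ.colorSorted c, F v ≤ (c.map fun i => (1 - ∑ p, F (θ.gen ⟨i, p⟩))⁻¹).prod := by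
  induction c with
  | nil =>
    refine (tsum_singleton (1 : θ.Semi) F).le.trans ?_
    simp
  | cons i c ih =>
    let f : List (Fin (n i)) × θ.colorSorted c → θ.colorSorted (i :: c) := fun x =>
      ⟨θ.word i x.1 * x.2, x.1, trivial, x.2, x.2.2, rfl⟩
    have hf : Function.Surjective f := by
      rintro ⟨_, l, -, w, hw, rfl⟩
      exact ⟨(l, ⟨w, hw⟩), rfl⟩
    refine (ENNReal.tsum_le_tsum_comp_of_surjective hf fun v => F v).trans ?_
    simp only [f, map_mul, List.map_cons, List.prod_cons]
    rw [ENNReal.tsum_prod']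
    simp only [ENNReal.tsum_mul_left, ENNReal.tsum_mul_right]
    rw [← ENNReal.tsum_list_prod_map]
    refine mul_le_mul' (le_of_eq ?_) ih
    refine tsum_congr fun l => ?_
    rw [word, map_list_prod, List.map_map]
    rfl

/-- A multiplicative weight on `𝔽⁺_θ` is summable if the total weight of the generators of each
colour is less than one. -/
theorem tsum_ne_top (F : θ.Semi →* ℝ≥0∞) (hF : ∀ i, ∑ p, F (θ.gen ⟨i, p⟩) < 1) :
    ∑' v, F v ≠ ∞ := by
  have h : ∑' v, F v ≤ ∑' v : θ.colorSorted (List.finRange r), F v := by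
    refine ENNReal.tsum_le_tsum_comp_of_surjective
      (f := fun v : θ.colorSorted (List.finRange r) => (v : θ.Semi)) ?_ F
    exact fun v => ⟨⟨v, θ.mem_colorSorted_finRange v⟩, rfl⟩
  refine ne_top_of_le_ne_top ?_ (h.trans (θ.tsum_colorSorted_le F _))
  have : ∀ c : List (Fin r), (c.map fun i => (1 - ∑ p, F (θ.gen ⟨i, p⟩))⁻¹).prod ≠ ∞ := by
    intro c
    induction c with
    | nil => simp
    | cons i c ih =>
      rw [List.map_cons, List.prod_cons]
      refine ENNReal.mul_ne_top ?_ ih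
      rw [ENNReal.inv_ne_top]
      exact (tsub_pos_of_lt (hF i)).ne'
  exact this _

/-- The character of `𝔽⁺_θ` with prescribed values on the generators of colour `j`, and vanishing
on the other generators. -/
def axisChar (j : Fin r) (z : Fin (n j) → ℂ) : θ.Semi →* ℂ :=
  θ.liftHom (fun g => if h : g.1 = j then z (h ▸ g.2) else 0) (by
    intro i k h p q
    by_cases hi : i = j
    · subst hi
      simp [h.ne']
    · simp [hi])

@[simp] theorem axisChar_gen_self (j : Fin r) (z : Fin (n j) → ℂ) (q : Fin (n j)) :
    θ.axisChar j z (θ.gen ⟨j, q⟩) = z q := by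
  simp [axisChar]

theorem axisChar_gen_of_ne {i j : Fin r} (h : i ≠ j) (z : Fin (n j) → ℂ) (p : Fin (n i)) :
    θ.axisChar j z (θ.gen ⟨i, p⟩) = 0 := by
  simp [axisChar, h]

/-- Words of colour `j` are free, so those of length `k` alone contribute `(∑ ‖z q‖²)^k = 1`. -/
theorem one_le_sum_axisChar (j : Fin r) (z : Fin (n j) → ℂ) (hz : ∑ q, ‖z q‖ ^ 2 = 1) (k : ℕ) :
    1 ≤ ∑ v : θ.Level k, ‖θ.axisChar j z v‖ ^ 2 := by
  let f : (Fin k → Fin (n j)) → θ.Level k := fun x =>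
    ⟨θ.word j (List.ofFn x), by simp [deg_word]⟩
  have hf : Function.Injective f := fun x y e =>
    List.ofFn_injective (θ.word_injective j (congrArg Subtype.val e))
  calc (1 : ℝ) = ∑ x : Fin k → Fin (n j), ∏ i, ‖z (x i)‖ ^ 2 := by
        rw [← Fintype.sum_pow (fun q => ‖z q‖ ^ 2), hz, one_pow]
    _ = ∑ x : Fin k → Fin (n j), ‖θ.axisChar j z (f x)‖ ^ 2 := by
        refine Finset.sum_congr rfl fun x _ => ?_
        simp only [f, word, map_list_prod, List.map_ofFn, List.prod_ofFn,
          Function.comp_apply, axisChar_gen_self, norm_prod, Finset.prod_pow]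
    _ ≤ _ := by
        refine (Finset.sum_map Finset.univ ⟨f, hf⟩
          fun v : θ.Level k => ‖θ.axisChar j z v‖ ^ 2).ge.trans ?_
        exact Finset.sum_le_sum_of_subset_of_nonneg (Finset.subset_univ _)
          fun _ _ _ => by positivity

end Semigroup

end PermSet

end HigherRank

end

noncomputable section

namespace HigherRank

namespace PermSet

/-! ### Fourier coefficients in the Toeplitz algebra and the degree filtration -/

section Operators

variable {r : ℕ} {n : Fin r → ℕ} (θ : PermSet n)

open Classical in
theorem xi_apply (w v : θ.Semi) : θ.xi w v = if v = w then 1 else 0 := by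
  simp [xi, Pi.single_apply]

theorem hasSum_xi (x : θ.Fock) : HasSum (fun w => x w • θ.xi w) x := by
  classical
  convert lp.hasSum_single (p := 2) ENNReal.ofNat_ne_top x using 2 with w
  rw [xi, ← lp.single_smul, smul_eq_mul, mul_one]

theorem clm_ext {E : Type*} [NormedAddCommGroup E] [NormedSpace ℂ E] {S T : θ.Fock →L[ℂ] E}
    (h : ∀ w, S (θ.xi w) = T (θ.xi w)) : S = T := by
  ext x
  have hS := (θ.hasSum_xi x).mapL S
  have hT := (θ.hasSum_xi x).mapL T
  simp only [map_smul, h] at hS hT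
  exact hS.unique hT

theorem norm_xi (w : θ.Semi) : ‖θ.xi w‖ = 1 := θ.orthonormal_xi.norm_eq_one w

theorem inner_xi_left (w : θ.Semi) (x : θ.Fock) : ⟪θ.xi w, x⟫_ℂ = x w := by
  classical
  rw [xi, lp.inner_single_left]
  simp

/-- An entry of `S x` vanishes if it does for all the basis vectors in the support of `x`. -/
theorem apply_eq_zero_of {r' : ℕ} {n' : Fin r' → ℕ} {θ' : PermSet n'} (S : θ.Fock →L[ℂ] θ'.Fock)
    (x : θ.Fock) (u : θ'.Semi) (h : ∀ w, x w ≠ 0 → S (θ.xi w) u = 0) : S x u = 0 := by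
  have hS := ((θ.hasSum_xi x).mapL S).mapL (lp.evalCLM ℂ (fun _ : θ'.Semi => ℂ) 2 u)
  have h0 : (fun w => lp.evalCLM ℂ (fun _ : θ'.Semi => ℂ) 2 u (S (x w • θ.xi w))) = 0 := by
    funext w
    by_cases hw : x w = 0
    · simp [hw]
    · rw [map_smul, map_smul]
      simp only [Pi.zero_apply, smul_eq_zero]
      exact Or.inr (h w hw)
  rw [h0] at hS
  exact hS.unique hasSum_zero

theorem finite_deg_lt (k : ℕ) : {v : θ.Semi | θ.deg v < k}.Finite := by
  have : {v : θ.Semi | θ.deg v < k} = ⋃ j ∈ Finset.range k, {v | θ.deg v = j} := by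
    ext v; simp
  rw [this]
  exact Set.Finite.biUnion (Finset.finite_toSet _) fun j _ => θ.finite_deg_eq j

variable [IsCancelMul θ.Semi]

theorem shift_one : θ.shift 1 = 1 := θ.clm_ext fun w => by simp [shift_xi]

theorem shift_mul (v w : θ.Semi) : θ.shift (v * w) = θ.shift v * θ.shift w :=
  θ.clm_ext fun u => by simp [shift_xi, mul_assoc]

@[simp] theorem shiftA_one : θ.shiftA 1 = 1 := Subtype.ext θ.shift_one

@[simp] theorem shiftA_mul (v w : θ.Semi) : θ.shiftA (v * w) = θ.shiftA v * θ.shiftA w :=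
  Subtype.ext (θ.shift_mul v w)

theorem shiftA_prod (l : List θ.Semi) : θ.shiftA l.prod = (l.map θ.shiftA).prod := by
  induction l with
  | nil => simp
  | cons v l ih => simp [ih]

theorem norm_shiftA_le (v : θ.Semi) : ‖θ.shiftA v‖ ≤ 1 :=
  (θ.orthonormal_xi_mul v).orthogonalFamily.linearIsometry.norm_toContinuousLinearMap_le

theorem orthonormal_xi_mul_right (w : θ.Semi) : Orthonormal ℂ (fun v => θ.xi (v * w)) :=
  θ.orthonormal_xi.comp _ (mul_left_injective w)

/-- The right shift isometry. -/
def rightShift (w : θ.Semi) : θ.Fock →L[ℂ] θ.Fock :=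
  (θ.orthonormal_xi_mul_right w).orthogonalFamily.linearIsometry.toContinuousLinearMap

theorem rightShift_xi (w v : θ.Semi) : θ.rightShift w (θ.xi v) = θ.xi (v * w) := by
  classical
  have := (θ.orthonormal_xi_mul_right w).orthogonalFamily.linearIsometry_apply_single
    (i := v) (1 : ℂ)
  simp [rightShift, xi] at this ⊢

/-- Left and right multiplications commute by associativity, and commutants are closed. Hence `X` is
determined by `X ξ_1`. -/
theorem mul_rightShift (X : θ.toeplitz) (w : θ.Semi) :
    (X : θ.Fock →L[ℂ] θ.Fock) * θ.rightShift w = θ.rightShift w * X := by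
  have h : θ.toeplitz ≤ Subalgebra.centralizer ℂ {θ.rightShift w} := by
    refine Subalgebra.topologicalClosure_minimal ?_ (Set.isClosed_centralizer _)
    rw [Algebra.adjoin_le_iff]
    rintro _ ⟨v, rfl⟩
    simp only [Subalgebra.coe_centralizer, Set.mem_centralizer_iff, Set.mem_singleton_iff,
      forall_eq]
    exact θ.clm_ext fun u => by simp [shift_xi, rightShift_xi, mul_assoc]
  exact (h X.2 _ rfl).symm

/-- The vector `X ξ_1`, as a function of `X ∈ 𝒜_θ`. -/
def vac : θ.toeplitz →L[ℂ] θ.Fock where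
  toFun X := (X : θ.Fock →L[ℂ] θ.Fock) (θ.xi 1)
  map_add' _ _ := rfl
  map_smul' _ _ := rfl
  cont := (ContinuousLinearMap.apply ℂ θ.Fock (θ.xi 1)).continuous.comp continuous_subtype_val

theorem vac_apply (X : θ.toeplitz) : θ.vac X = (X : θ.Fock →L[ℂ] θ.Fock) (θ.xi 1) := rfl

theorem apply_xi (X : θ.toeplitz) (w : θ.Semi) :
    (X : θ.Fock →L[ℂ] θ.Fock) (θ.xi w) = θ.rightShift w (θ.vac X) := by
  have := DFunLike.congr_fun (θ.mul_rightShift X w) (θ.xi 1)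
  simpa [rightShift_xi, vac_apply] using this

theorem vac_mul (X Y : θ.toeplitz) :
    θ.vac (X * Y) = (X : θ.Fock →L[ℂ] θ.Fock) (θ.vac Y) := rfl

@[simp] theorem vac_shiftA (v : θ.Semi) : θ.vac (θ.shiftA v) = θ.xi v := by
  simp [vac_apply, shiftA, shift_xi]

theorem vac_injective : Function.Injective θ.vac := fun X Y h =>
  Subtype.ext <| θ.clm_ext fun w => by rw [apply_xi, apply_xi, h]

theorem norm_vac_le (X : θ.toeplitz) : ‖θ.vac X‖ ≤ ‖X‖ := by
  have := (X : θ.Fock →L[ℂ] θ.Fock).le_opNorm (θ.xi 1)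
  rwa [norm_xi, mul_one] at this

/-- The shifts already form a monoid, so the algebra they generate is their linear span. -/
theorem dense_span_shiftA : Dense (Submodule.span ℂ (Set.range θ.shiftA) : Set θ.toeplitz) := by
  have hcl : (Submonoid.closure (Set.range θ.shift) : Set (θ.Fock →L[ℂ] θ.Fock)) =
      Set.range θ.shift := by
    let f : θ.Semi →* (θ.Fock →L[ℂ] θ.Fock) :=
      { toFun := θ.shift, map_one' := θ.shift_one, map_mul' := θ.shift_mul }
    have : Set.range θ.shift = (MonoidHom.mrange f : Set _) := rfl
    rw [this, Submonoid.closure_eq]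
  have himg : (Subtype.val : θ.toeplitz → θ.Fock →L[ℂ] θ.Fock) ''
      (Submodule.span ℂ (Set.range θ.shiftA) : Set θ.toeplitz) =
      (Algebra.adjoin ℂ (Set.range θ.shift) : Set (θ.Fock →L[ℂ] θ.Fock)) := by
    rw [← Subalgebra.coe_toSubmodule, Algebra.adjoin_eq_span, hcl]
    have := Submodule.map_span (Subalgebra.toSubmodule θ.toeplitz).subtype (Set.range θ.shiftA)
    rw [← Set.range_comp] at this
    exact congrArg (fun p : Submodule ℂ (θ.Fock →L[ℂ] θ.Fock) => 
      (p : Set (θ.Fock →L[ℂ] θ.Fock))) this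
  intro X
  rw [Topology.IsInducing.subtypeVal.closure_eq_preimage_closure_image]
  exact (congrArg closure himg).ge X.2

theorem toeplitz_clm_ext {E : Type*} [NormedAddCommGroup E] [NormedSpace ℂ E]
    {S T : θ.toeplitz →L[ℂ] E} (h : ∀ v, S (θ.shiftA v) = T (θ.shiftA v)) : S = T :=
  ContinuousLinearMap.ext_on θ.dense_span_shiftA (by rintro _ ⟨v, rfl⟩; exact h v)

/-- The operators in `𝒜_θ` whose Fourier coefficients vanish in total degree less than `k`. -/
def filt (k : ℕ) : Submodule ℂ θ.toeplitz where
  carrier := {X | ∀ v, θ.deg v < k → θ.vac X v = 0}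
  zero_mem' v _ := by simp
  add_mem' hX hY v hv := by
    rw [map_add, lp.coeFn_add, Pi.add_apply, hX v hv, hY v hv, add_zero]
  smul_mem' c X hX v hv := by
    rw [map_smul, lp.coeFn_smul, Pi.smul_apply, hX v hv, smul_zero]

theorem mem_filt {k : ℕ} {X : θ.toeplitz} :
    X ∈ θ.filt k ↔ ∀ v, θ.deg v < k → θ.vac X v = 0 := Iff.rfl

theorem shiftA_mem_filt (v : θ.Semi) : θ.shiftA v ∈ θ.filt (θ.deg v) := by
  intro w hw
  rw [vac_shiftA, xi_apply, if_neg]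
  rintro rfl
  exact lt_irrefl _ hw

theorem filt_anti {k l : ℕ} (h : k ≤ l) : θ.filt l ≤ θ.filt k :=
  fun _ hX v hv => hX v (hv.trans_le h)

/-- `Y ξ_1` involves only `ξ_w` of degree at least `b`, and `X ξ_w` is the right translate by `w` of
`X ξ_1`. -/
theorem mul_mem_filt {a b : ℕ} {X Y : θ.toeplitz} (hX : X ∈ θ.filt a) (hY : Y ∈ θ.filt b) :
    X * Y ∈ θ.filt (a + b) := by
  intro u hu
  rw [vac_mul]
  refine θ.apply_eq_zero_of _ _ _ fun w hw => ?_
  have hbw : b ≤ θ.deg w := not_lt.1 fun h => hw (hY w h)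
  rw [apply_xi]
  refine θ.apply_eq_zero_of _ _ _ fun v hv => ?_
  have hav : a ≤ θ.deg v := not_lt.1 fun h => hv (hX v h)
  rw [rightShift_xi, xi_apply, if_neg]
  rintro rfl
  rw [deg_mul] at hu
  omega

theorem mem_filt_one_iff {X : θ.toeplitz} : X ∈ θ.filt 1 ↔ X ∈ θ.zeroConst := by
  rw [zeroConst, Set.mem_ofPred_eq, inner_xi_left, mem_filt]
  refine ⟨fun h => h 1 (by simp), fun h v hv => ?_⟩
  rw [θ.eq_one_of_deg_eq_zero (Nat.lt_one_iff.1 hv)]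
  exact h

/-- Removing the terms of total degree less than `k`. -/
def truncate (k : ℕ) : θ.toeplitz →L[ℂ] θ.toeplitz :=
  .id ℂ _ - ∑ v ∈ (θ.finite_deg_lt k).toFinset,
    ((lp.evalCLM ℂ (fun _ : θ.Semi => ℂ) 2 v).comp θ.vac).smulRight (θ.shiftA v)

theorem truncate_apply (k : ℕ) (X : θ.toeplitz) :
    θ.truncate k X = X - ∑ v ∈ (θ.finite_deg_lt k).toFinset, θ.vac X v • θ.shiftA v := by
  simp [truncate]
  rfl

theorem truncate_of_mem {k : ℕ} {X : θ.toeplitz} (hX : X ∈ θ.filt k) : θ.truncate k X = X := by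
  rw [truncate_apply, Finset.sum_eq_zero, sub_zero]
  intro v hv
  rw [hX v (by simpa using hv), zero_smul]

theorem truncate_shiftA_of_lt {k : ℕ} {v : θ.Semi} (hv : θ.deg v < k) :
    θ.truncate k (θ.shiftA v) = 0 := by
  rw [truncate_apply, Finset.sum_eq_single v, vac_shiftA, xi_apply, if_pos rfl, one_smul, sub_self]
  · intro w _ hw
    rw [vac_shiftA, xi_apply, if_neg hw, zero_smul]
  · intro h
    simp [hv] at h

/-- An operator whose coefficients are supported in degree `k` is a finite combination of shifts. -/
theorem eq_sum_level {k : ℕ} {X : θ.toeplitz} (hX : ∀ v, θ.deg v ≠ k → θ.vac X v = 0) :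
    X = ∑ v : θ.Level k, θ.vac X v • θ.shiftA v := by
  apply θ.vac_injective
  rw [map_sum]
  simp only [map_smul, vac_shiftA]
  have h := θ.hasSum_xi (θ.vac X)
  refine h.unique ?_
  have hk : ∀ v ∉ (Finset.univ.map ⟨((↑) : θ.Level k → θ.Semi), Subtype.val_injective⟩),
      θ.vac X v • θ.xi v = 0 := by
    intro v hv
    rw [hX v fun h => hv (by simpa using h), zero_smul]
  have := hasSum_sum_of_ne_finset_zero (L := .unconditional _) hk
  rwa [Finset.sum_map] at this

end Operators

end PermSet

end HigherRank

end

/-! ### Unitarity in each degree, gradedness and the implementing unitary -/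

noncomputable section

namespace HigherRank

/-- Mutually inverse complex matrices whose rows have norm at most one are adjoint to each other. -/
theorem _root_.Matrix.eq_conjTranspose_of_row_norm_le {a b : Type*} [Fintype a] [Fintype b]
    [DecidableEq a] [DecidableEq b] {T : Matrix a b ℂ} {S : Matrix b a ℂ} (hTS : T * S = 1)
    (hST : S * T = 1) (hT : ∀ w, ∑ v, ‖T w v‖ ^ 2 ≤ 1) (hS : ∀ v, ∑ w, ‖S v w‖ ^ 2 ≤ 1) :
    S = T.conjTranspose := by
  have htr : (S * T).trace = (Fintype.card b : ℂ) := by rw [hST, Matrix.trace_one]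
  have htr' : (S * T).trace = (Fintype.card a : ℂ) := by
    rw [Matrix.trace_mul_comm, hTS, Matrix.trace_one]
  have hcard : (Fintype.card a : ℝ) = Fintype.card b := by
    exact_mod_cast htr'.symm.trans htr
  have key : ∀ x y : ℂ, ‖x - star y‖ ^ 2 = ‖x‖ ^ 2 + ‖y‖ ^ 2 - 2 * (x * y).re := by
    intro x y
    rw [← Complex.normSq_eq_norm_sq, ← Complex.normSq_eq_norm_sq, ← Complex.normSq_eq_norm_sq]
    simp only [Complex.normSq_apply, Complex.sub_re, Complex.sub_im, Complex.star_def,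
      Complex.conj_re, Complex.conj_im, Complex.mul_re]
    ring
  have hre : ∑ v, ∑ w, (S v w * T w v).re = Fintype.card b := by
    have := congrArg Complex.re htr
    simpa [Matrix.trace, Matrix.mul_apply] using this
  -- The squared Hilbert–Schmidt distance from `S` to `T*` is `‖S‖² + ‖T‖² - 2 Re tr(ST)`, at most
  -- `|b| + |a| - 2|b|`, and `|a| = |b|`.
  have hsum : ∑ v, ∑ w, ‖S v w - star (T w v)‖ ^ 2 ≤ 0 := by
    simp only [key, Finset.sum_sub_distrib, Finset.sum_add_distrib, ← Finset.mul_sum, hre]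
    have h1 : ∑ v, ∑ w, ‖S v w‖ ^ 2 ≤ Fintype.card b := by
      simpa using Finset.sum_le_sum fun v (_ : v ∈ Finset.univ) => hS v
    have h2 : ∑ v, ∑ w, ‖T w v‖ ^ 2 ≤ Fintype.card a := by
      rw [Finset.sum_comm]
      simpa using Finset.sum_le_sum fun v (_ : v ∈ Finset.univ) => hT v
    linarith
  have h0 : ∑ v, ∑ w, ‖S v w - star (T w v)‖ ^ 2 = 0 :=
    le_antisymm hsum (by positivity)
  ext v w
  rw [Finset.sum_eq_zero_iff_of_nonneg fun _ _ => by positivity] at h0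
  have h1 := h0 v (Finset.mem_univ _)
  rw [Finset.sum_eq_zero_iff_of_nonneg fun _ _ => by positivity] at h1
  have h2 := h1 w (Finset.mem_univ _)
  rw [Matrix.conjTranspose_apply]
  simpa [sub_eq_zero] using h2

section Isomorphism

open PermSet

variable {r s : ℕ} {n : Fin r → ℕ} {m : Fin s → ℕ} {θ : PermSet n} {τ : PermSet m}
  [IsCancelMul θ.Semi] [IsCancelMul τ.Semi]

/-- `Φ` is isometric and preserves the ideal of operators with vanishing constant term. -/
structure IsVacuumIsometry (Φ : θ.toeplitz ≃ₐ[ℂ] τ.toeplitz) : Prop where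
  norm_map : ∀ X, ‖Φ X‖ = ‖X‖
  mem_filt_one : ∀ X, Φ X ∈ τ.filt 1 ↔ X ∈ θ.filt 1

namespace IsVacuumIsometry

variable {Φ : θ.toeplitz ≃ₐ[ℂ] τ.toeplitz}

theorem of_isometry (hΦ : Isometry Φ) (hI : Φ '' θ.zeroConst = τ.zeroConst) :
    IsVacuumIsometry Φ where
  norm_map X := by
    have := hΦ.dist_eq X 0
    rwa [map_zero, dist_zero_right, dist_zero_right] at this
  mem_filt_one X := by
    rw [mem_filt_one_iff, mem_filt_one_iff, ← hI, Φ.injective.mem_set_image]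

theorem symm (h : IsVacuumIsometry Φ) : IsVacuumIsometry Φ.symm where
  norm_map X := by rw [← h.norm_map, AlgEquiv.apply_symm_apply]
  mem_filt_one X := by rw [← h.mem_filt_one, AlgEquiv.apply_symm_apply]

/-- `Φ` as a continuous linear map. -/
def toCLM (h : IsVacuumIsometry Φ) : θ.toeplitz →L[ℂ] τ.toeplitz :=
  Φ.toLinearMap.mkContinuous 1 fun X => by
    rw [one_mul]
    exact (h.norm_map X).le

@[simp] theorem toCLM_apply (h : IsVacuumIsometry Φ) (X : θ.toeplitz) : h.toCLM X = Φ X := rfl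

theorem map_shiftA_mem_filt (h : IsVacuumIsometry Φ) (v : θ.Semi) :
    Φ (θ.shiftA v) ∈ τ.filt (θ.deg v) := by
  induction v using θ.semi_induction with
  | one =>
    intro v hv
    simp at hv
  | gen_mul g v ih =>
    rw [shiftA_mul, map_mul, deg_mul]
    refine τ.mul_mem_filt ?_ ih
    rw [deg_gen, h.mem_filt_one]
    simpa using θ.shiftA_mem_filt (θ.gen g)

/-- Truncation is continuous and fixes `filt k`, so the claim reduces by density to shifts, which it
kills or keeps according to degree. No Fourier series of `X` has to converge. -/
theorem map_mem_filt (h : IsVacuumIsometry Φ) {k : ℕ} {X : θ.toeplitz} (hX : X ∈ θ.filt k) :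
    Φ X ∈ τ.filt k := by
  intro u hu
  let S : θ.toeplitz →L[ℂ] ℂ :=
    (lp.evalCLM ℂ (fun _ : τ.Semi => ℂ) 2 u).comp (τ.vac.comp (h.toCLM.comp (θ.truncate k)))
  have hS : S = 0 := by
    refine θ.toeplitz_clm_ext fun v => ?_
    change τ.vac (Φ (θ.truncate k (θ.shiftA v))) u = 0
    by_cases hv : θ.deg v < k
    · simp [θ.truncate_shiftA_of_lt hv]
    · rw [not_lt] at hv
      rw [θ.truncate_of_mem (θ.filt_anti hv (θ.shiftA_mem_filt v))]
      exact τ.filt_anti hv (h.map_shiftA_mem_filt v) u hu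
  have : S X = τ.vac (Φ X) u := by
    change τ.vac (Φ (θ.truncate k X)) u = _
    rw [θ.truncate_of_mem hX]
  rw [← this, hS]
  rfl

variable (Φ) in
/-- The matrix of `Φ` in total degree `k`. -/
def levelMatrix (k : ℕ) : Matrix (θ.Level k) (τ.Level k) ℂ := fun w v =>
  τ.vac (Φ (θ.shiftA w)) v

theorem sub_sum_mem_filt (h : IsVacuumIsometry Φ) {k : ℕ} (w : θ.Level k) :
    Φ (θ.shiftA w) - ∑ v : τ.Level k, levelMatrix Φ k w v • τ.shiftA v ∈ τ.filt (k + 1) := by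
  intro u hu
  simp only [map_sub, map_sum, map_smul, vac_shiftA, lp.coeFn_sub, lp.coeFn_sum, Pi.sub_apply,
    Finset.sum_apply, lp.coeFn_smul, Pi.smul_apply, xi_apply, smul_eq_mul, mul_ite, mul_one,
    mul_zero]
  rcases (Nat.lt_succ_iff.1 hu).lt_or_eq with hk | hk
  · have h1 := h.map_shiftA_mem_filt w u (by rwa [w.2])
    rw [h1, Finset.sum_eq_zero, sub_zero]
    rintro v -
    rw [if_neg]
    rintro rfl
    exact hk.ne v.2
  · rw [Finset.sum_eq_single ⟨u, hk⟩]
    · simp [levelMatrix]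
    · rintro v - hv
      rw [if_neg]
      rintro rfl
      exact hv rfl
    · simp

theorem levelMatrix_mul_symm (h : IsVacuumIsometry Φ) (k : ℕ) :
    levelMatrix Φ k * levelMatrix Φ.symm k = 1 := by
  ext w u
  -- The remainder of `Φ(L_w)` lies in degree at least `k + 1`, and `Φ.symm` keeps it there, so it
  -- is invisible at `u`.
  have h1 := h.symm.map_mem_filt (h.sub_sum_mem_filt w) u (by rw [u.2]; exact Nat.lt_succ_self k)
  simp only [map_sub, map_sum, map_smul, AlgEquiv.symm_apply_apply, vac_shiftA, lp.coeFn_sub,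
    lp.coeFn_sum, Pi.sub_apply, Finset.sum_apply, lp.coeFn_smul, Pi.smul_apply, smul_eq_mul,
    xi_apply] at h1
  rw [Matrix.mul_apply, Matrix.one_apply]
  rw [sub_eq_zero] at h1
  simp only [levelMatrix] at h1 ⊢
  rw [← h1]
  by_cases e : w = u
  · subst e
    simp
  · rw [if_neg e, if_neg fun e' => e (Subtype.ext e'.symm)]

theorem symm_mul_levelMatrix (h : IsVacuumIsometry Φ) (k : ℕ) :
    levelMatrix Φ.symm k * levelMatrix Φ k = 1 := by
  simpa using h.symm.levelMatrix_mul_symm k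

theorem sum_norm_sq_le (h : IsVacuumIsometry Φ) (w : θ.Semi) (t : Finset τ.Semi) :
    ∑ v ∈ t, ‖τ.vac (Φ (θ.shiftA w)) v‖ ^ 2 ≤ 1 := by
  have h1 := τ.orthonormal_xi.sum_inner_products_le (s := t) (τ.vac (Φ (θ.shiftA w)))
  simp only [inner_xi_left] at h1
  refine h1.trans (pow_le_one₀ (norm_nonneg _) ((τ.norm_vac_le _).trans ?_))
  rw [h.norm_map]
  exact θ.norm_shiftA_le w

/-- The elements of total degree `k`, as a finite set. -/
def levelFinset (τ : PermSet m) (k : ℕ) : Finset τ.Semi :=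
  Finset.univ.map ⟨((↑) : τ.Level k → τ.Semi), Subtype.val_injective⟩

theorem sum_norm_sq_levelMatrix_le (h : IsVacuumIsometry Φ) {k : ℕ} (w : θ.Level k) :
    ∑ v, ‖levelMatrix Φ k w v‖ ^ 2 ≤ 1 := by
  have := h.sum_norm_sq_le w (levelFinset τ k)
  rwa [levelFinset, Finset.sum_map] at this

theorem levelMatrix_symm (h : IsVacuumIsometry Φ) (k : ℕ) :
    levelMatrix Φ.symm k = (levelMatrix Φ k).conjTranspose :=
  Matrix.eq_conjTranspose_of_row_norm_le (h.levelMatrix_mul_symm k) (h.symm_mul_levelMatrix k)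
    h.sum_norm_sq_levelMatrix_le h.symm.sum_norm_sq_levelMatrix_le

theorem levelMatrix_mul_conjTranspose (h : IsVacuumIsometry Φ) (k : ℕ) :
    levelMatrix Φ k * (levelMatrix Φ k).conjTranspose = 1 := by
  rw [← h.levelMatrix_symm, h.levelMatrix_mul_symm]

theorem conjTranspose_mul_levelMatrix (h : IsVacuumIsometry Φ) (k : ℕ) :
    (levelMatrix Φ k).conjTranspose * levelMatrix Φ k = 1 := by
  rw [← h.levelMatrix_symm, h.symm_mul_levelMatrix]

theorem sum_norm_sq_levelMatrix (h : IsVacuumIsometry Φ) {k : ℕ} (w : θ.Level k) :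
    ∑ v, ‖levelMatrix Φ k w v‖ ^ 2 = 1 := by
  have h1 := congrFun (congrFun (h.levelMatrix_mul_conjTranspose k) w) w
  rw [Matrix.mul_apply, Matrix.one_apply_eq] at h1
  have h2 : ((∑ v, ‖levelMatrix Φ k w v‖ ^ 2 : ℝ) : ℂ) = 1 := by
    rw [← h1]
    push_cast
    refine Finset.sum_congr rfl fun v _ => ?_
    rw [Matrix.conjTranspose_apply, Complex.star_def, Complex.mul_conj']
  exact_mod_cast h2

/-- `Φ` preserves the total degree. -/
theorem vac_map_shiftA_eq_zero (h : IsVacuumIsometry Φ) {w : θ.Semi} {u : τ.Semi}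
    (hu : τ.deg u ≠ θ.deg w) : τ.vac (Φ (θ.shiftA w)) u = 0 := by
  have hu' : u ∉ levelFinset τ (θ.deg w) := by simpa [levelFinset] using hu
  -- The coefficients in degree `θ.deg w` already use up the whole Bessel bound.
  have h1 := h.sum_norm_sq_le w (Finset.cons u _ hu')
  have h2 := h.sum_norm_sq_levelMatrix (k := θ.deg w) ⟨w, rfl⟩
  rw [Finset.sum_cons, levelFinset, Finset.sum_map] at h1
  simp only [levelMatrix] at h2
  simp only [Function.Embedding.coeFn_mk, h2] at h1
  have h3 : ‖τ.vac (Φ (θ.shiftA w)) u‖ ^ 2 = 0 := le_antisymm (by linarith) (by positivity)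
  simpa using h3

theorem map_shiftA (h : IsVacuumIsometry Φ) {k : ℕ} (w : θ.Level k) :
    Φ (θ.shiftA w) = ∑ v : τ.Level k, levelMatrix Φ k w v • τ.shiftA v :=
  τ.eq_sum_level fun v hv => h.vac_map_shiftA_eq_zero (by rwa [w.2])

theorem vac_map_shiftA (h : IsVacuumIsometry Φ) {k : ℕ} (w : θ.Level k) :
    τ.vac (Φ (θ.shiftA w)) = ∑ v : τ.Level k, levelMatrix Φ k w v • τ.xi v := by
  rw [h.map_shiftA]
  simp

theorem orthonormal_vac (h : IsVacuumIsometry Φ) :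
    Orthonormal ℂ fun w : θ.Semi => τ.vac (Φ (θ.shiftA w)) := by
  classical
  rw [orthonormal_iff_ite]
  intro w w'
  rw [h.vac_map_shiftA (⟨w, rfl⟩ : θ.Level (θ.deg w)), sum_inner]
  simp only [inner_smul_left, inner_xi_left]
  by_cases hd : θ.deg w' = θ.deg w
  · have h1 := congrFun (congrFun (h.levelMatrix_mul_conjTranspose (θ.deg w)) ⟨w', hd⟩) ⟨w, rfl⟩
    rw [Matrix.mul_apply, Matrix.one_apply] at h1
    simp only [Subtype.mk.injEq] at h1
    simp only [eq_comm (a := w)]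
    rw [← h1]
    refine Finset.sum_congr rfl fun v _ => ?_
    rw [Matrix.conjTranspose_apply, mul_comm]
    rfl
  · rw [if_neg fun e : w = w' => hd (e ▸ rfl)]
    refine Finset.sum_eq_zero fun v _ => ?_
    rw [h.vac_map_shiftA_eq_zero (by rw [v.2]; exact Ne.symm hd), mul_zero]

theorem top_le_closure_span_vac (h : IsVacuumIsometry Φ) :
    ⊤ ≤ (Submodule.span ℂ
      (Set.range fun w : θ.Semi => τ.vac (Φ (θ.shiftA w)))).topologicalClosure := by
  set p := Submodule.span ℂ (Set.range fun w : θ.Semi => τ.vac (Φ (θ.shiftA w)))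
  have hxi : ∀ v, τ.xi v ∈ p := by
    intro v
    -- `Φ.symm` is graded too, so the inner operator is a finite combination of shifts.
    have h1 : τ.xi v = τ.vac (Φ (Φ.symm (τ.shiftA v))) := by simp
    rw [h1, h.symm.map_shiftA (⟨v, rfl⟩ : τ.Level (τ.deg v))]
    simp only [map_sum, map_smul]
    exact Submodule.sum_mem _ fun w _ => Submodule.smul_mem _ _ (Submodule.subset_span ⟨w, rfl⟩)
  intro x _
  refine mem_closure_of_tendsto (τ.hasSum_xi x) (Filter.Eventually.of_forall fun t => ?_)
  exact Submodule.sum_mem _ fun v _ => Submodule.smul_mem _ _ (hxi v)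

/-- The unitary operator that implements `Φ`. -/
def unitary (h : IsVacuumIsometry Φ) : θ.Fock ≃ₗᵢ[ℂ] τ.Fock :=
  (HilbertBasis.mk h.orthonormal_vac h.top_le_closure_span_vac).repr.symm

theorem unitary_xi (h : IsVacuumIsometry Φ) (w : θ.Semi) :
    h.unitary (θ.xi w) = τ.vac (Φ (θ.shiftA w)) := by
  classical
  rw [unitary, xi, HilbertBasis.repr_symm_single, HilbertBasis.coe_mk]

theorem unitary_vac (h : IsVacuumIsometry Φ) (X : θ.toeplitz) :
    h.unitary (θ.vac X) = τ.vac (Φ X) := by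
  let S : θ.toeplitz →L[ℂ] τ.Fock :=
    (h.unitary.toContinuousLinearEquiv : θ.Fock →L[ℂ] τ.Fock).comp θ.vac
  have : S = τ.vac.comp h.toCLM := θ.toeplitz_clm_ext fun v => by
    change h.unitary (θ.vac (θ.shiftA v)) = τ.vac (Φ (θ.shiftA v))
    rw [vac_shiftA, unitary_xi]
  exact DFunLike.congr_fun this X

theorem map_apply_unitary (h : IsVacuumIsometry Φ) (X : θ.toeplitz) (x : θ.Fock) :
    (Φ X : τ.Fock →L[ℂ] τ.Fock) (h.unitary x) =
      h.unitary ((X : θ.Fock →L[ℂ] θ.Fock) x) := by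
  let V : θ.Fock →L[ℂ] τ.Fock := (h.unitary.toContinuousLinearEquiv : θ.Fock →L[ℂ] τ.Fock)
  have : (Φ X : τ.Fock →L[ℂ] τ.Fock).comp V = V.comp (X : θ.Fock →L[ℂ] θ.Fock) := by
    refine θ.clm_ext fun w => ?_
    change (Φ X : τ.Fock →L[ℂ] τ.Fock) (h.unitary (θ.xi w)) =
      h.unitary ((X : θ.Fock →L[ℂ] θ.Fock) (θ.xi w))
    -- `Φ(X) U ξ_w = Φ(X) Φ(L_w) ξ_1 = Φ(X L_w) ξ_1 = U X L_w ξ_1 = U X ξ_w`.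
    rw [unitary_xi, ← vac_mul, ← map_mul, ← unitary_vac, vac_mul, vac_shiftA]
  exact DFunLike.congr_fun this x

theorem map_apply (h : IsVacuumIsometry Φ) (X : θ.toeplitz) (y : τ.Fock) :
    (Φ X : τ.Fock →L[ℂ] τ.Fock) y =
      h.unitary ((X : θ.Fock →L[ℂ] θ.Fock) (h.unitary.symm y)) := by
  rw [← map_apply_unitary, LinearIsometryEquiv.apply_symm_apply]

end IsVacuumIsometry

end Isomorphism

end HigherRank

end

/-! ### Characters, the bijection of colours and the commutation relations -/

noncomputable section

namespace HigherRank

theorem _root_.Complex.star_dotProduct_self {a : Type*} [Fintype a] (x : a → ℂ) :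
    star x ⬝ᵥ x = ((∑ v, ‖x v‖ ^ 2 : ℝ) : ℂ) := by
  rw [dotProduct]
  push_cast
  refine Finset.sum_congr rfl fun v _ => ?_
  rw [Pi.star_apply, Complex.star_def, Complex.conj_mul']

/-- A matrix with orthonormal columns preserves the Euclidean norm. -/
theorem _root_.Matrix.sum_norm_sq_mulVec {a b : Type*} [Fintype a] [Fintype b] [DecidableEq b]
    {T : Matrix a b ℂ} (hT : T.conjTranspose * T = 1) (x : b → ℂ) :
    ∑ w, ‖(T.mulVec x) w‖ ^ 2 = ∑ v, ‖x v‖ ^ 2 := by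
  have h : star (T.mulVec x) ⬝ᵥ T.mulVec x = star x ⬝ᵥ x := by
    rw [Matrix.star_mulVec, Matrix.dotProduct_mulVec, Matrix.vecMul_vecMul, hT, Matrix.vecMul_one]
  rw [Complex.star_dotProduct_self, Complex.star_dotProduct_self] at h
  exact_mod_cast h

section Colors

open PermSet

/-- The elements of degree one are the generators. -/
def PermSet.genEquiv {r : ℕ} {n : Fin r → ℕ} (θ : PermSet n) : Gen n ≃ θ.Level 1 :=
  Equiv.ofBijective (fun g => ⟨θ.gen g, θ.deg_gen g⟩)
    ⟨fun _ _ e => θ.gen_injective (congrArg Subtype.val e), fun ⟨_, hv⟩ =>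
      let ⟨g, hg⟩ := θ.exists_gen_of_deg_eq_one hv
      ⟨g, Subtype.ext hg.symm⟩⟩

@[simp] theorem PermSet.coe_genEquiv {r : ℕ} {n : Fin r → ℕ} (θ : PermSet n) (g : Gen n) :
    (θ.genEquiv g : θ.Semi) = θ.gen g := rfl

theorem PermSet.sum_level_one {r : ℕ} {n : Fin r → ℕ} (θ : PermSet n) {E : Type*}
    [AddCommMonoid E] (f : θ.Level 1 → E) :
    ∑ v, f v = ∑ i, ∑ p, f (θ.genEquiv ⟨i, p⟩) := by
  rw [← θ.genEquiv.sum_comp, Fintype.sum_sigma]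

theorem PermSet.sum_xi_mul {r : ℕ} {n : Fin r → ℕ} (θ : PermSet n) {d : ℕ} {a : θ.Semi}
    (ha : θ.deg a = d) (f : θ.Semi → ℂ) : ∑ u : θ.Level d, θ.xi a u * f u = f a := by
  rw [Finset.sum_eq_single ⟨a, ha⟩]
  · simp [xi_apply]
  · rintro u - hu
    rw [xi_apply, if_neg fun e => hu (Subtype.ext e), zero_mul]
  · simp

open scoped ENNReal

/-- A character of `𝔽⁺_θ` whose values on every level have norm at least one has a colour on whose
generators its norm is at least one. -/
theorem PermSet.exists_one_le_sum_color {r : ℕ} {n : Fin r → ℕ} (θ : PermSet n)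
    (χ : θ.Semi →* ℂ) (hχ : ∀ k, 1 ≤ ∑ v : θ.Level k, ‖χ v‖ ^ 2) :
    ∃ i, 1 ≤ ∑ p, ‖χ (θ.gen ⟨i, p⟩)‖ ^ 2 := by
  by_contra! hlt
  let F : θ.Semi →* ℝ≥0∞ :=
    { toFun := fun v => ENNReal.ofReal (‖χ v‖ ^ 2)
      map_one' := by simp
      map_mul' := fun v w => by
        rw [map_mul, norm_mul, mul_pow, ENNReal.ofReal_mul (by positivity)] }
  have hF : ∀ v, F v = ENNReal.ofReal (‖χ v‖ ^ 2) := fun _ => rfl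
  refine θ.tsum_ne_top F (fun i => ?_) ?_
  · simp only [hF]
    rw [← ENNReal.ofReal_sum_of_nonneg fun _ _ => by positivity, ENNReal.ofReal_lt_one]
    exact hlt i
  -- Grouped by degree, infinitely many levels each contribute at least one.
  · rw [← (Equiv.sigmaFiberEquiv θ.deg).tsum_eq, ENNReal.tsum_sigma', eq_top_iff,
      ← ENNReal.tsum_const_eq_top_of_ne_zero (α := ℕ) (c := 1) one_ne_zero]
    refine ENNReal.tsum_le_tsum fun k => ?_
    change 1 ≤ ∑' v : θ.Level k, F v
    rw [tsum_fintype]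
    simp only [hF]
    rw [← ENNReal.ofReal_sum_of_nonneg fun _ _ => by positivity, ENNReal.one_le_ofReal]
    exact hχ k

variable {r s : ℕ} {n : Fin r → ℕ} {m : Fin s → ℕ} {θ : PermSet n} {τ : PermSet m}
  [IsCancelMul θ.Semi] [IsCancelMul τ.Semi]

namespace IsVacuumIsometry

variable {Φ : θ.toeplitz ≃ₐ[ℂ] τ.toeplitz}

/-- The character of `𝔽⁺_θ` that corresponds under `Φ` to a character of `𝔽⁺_τ`. -/
def pullback (h : IsVacuumIsometry Φ) (ρ : τ.Semi →* ℂ) : θ.Semi →* ℂ where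
  -- By gradedness `Φ(L_v)` is a finite combination of shifts, so `ρ` can be evaluated on it without
  -- any continuity.
  toFun v := ∑ u : τ.Level (θ.deg v), τ.vac (Φ (θ.shiftA v)) u * ρ u
  map_one' := by
    rw [shiftA_one, map_one, ← shiftA_one, vac_shiftA, sum_xi_mul τ (by simp) ρ, map_one]
  map_mul' v w := by
    have key : τ.vac (Φ (θ.shiftA (v * w))) = ∑ a : τ.Level (θ.deg v), ∑ b : τ.Level (θ.deg w),
        (τ.vac (Φ (θ.shiftA v)) a * τ.vac (Φ (θ.shiftA w)) b) • τ.xi (a * b) := by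
      rw [shiftA_mul, map_mul]
      refine (congrArg τ.vac (congrArg₂ (· * ·) (h.map_shiftA (⟨v, rfl⟩ : θ.Level (θ.deg v)))
        (h.map_shiftA (⟨w, rfl⟩ : θ.Level (θ.deg w))))).trans ?_
      simp only [Finset.sum_mul_sum, smul_mul_smul_comm, ← shiftA_mul, map_sum, map_smul,
        vac_shiftA, levelMatrix]
    rw [Finset.sum_mul_sum, key]
    simp only [lp.coeFn_sum, Finset.sum_apply, lp.coeFn_smul, Pi.smul_apply, smul_eq_mul,
      Finset.sum_mul]
    rw [Finset.sum_comm]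
    refine Finset.sum_congr rfl fun a _ => ?_
    rw [Finset.sum_comm]
    refine Finset.sum_congr rfl fun b _ => ?_
    simp only [mul_assoc]
    rw [← Finset.mul_sum, ← Finset.mul_sum,
      sum_xi_mul τ (by rw [deg_mul, deg_mul, a.2, b.2]) ρ, map_mul]
    ring

theorem pullback_apply (h : IsVacuumIsometry Φ) (ρ : τ.Semi →* ℂ) {k : ℕ} (w : θ.Level k) :
    h.pullback ρ w = (levelMatrix Φ k).mulVec (fun u => ρ u) w := by
  obtain ⟨w, rfl⟩ := w
  rfl

theorem sum_norm_sq_pullback (h : IsVacuumIsometry Φ) (ρ : τ.Semi →* ℂ) (k : ℕ) :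
    ∑ w : θ.Level k, ‖h.pullback ρ w‖ ^ 2 = ∑ v : τ.Level k, ‖ρ v‖ ^ 2 := by
  simp only [h.pullback_apply]
  exact Matrix.sum_norm_sq_mulVec (h.conjTranspose_mul_levelMatrix k) _

variable (Φ) in
/-- The matrix of the action of `Φ` on the generators. -/
def genMatrix : Matrix (Gen n) (Gen m) ℂ := (levelMatrix Φ 1).submatrix θ.genEquiv τ.genEquiv

theorem genMatrix_mul_conjTranspose (h : IsVacuumIsometry Φ) :
    genMatrix Φ * (genMatrix Φ).conjTranspose = 1 := by
  rw [genMatrix, Matrix.conjTranspose_submatrix, Matrix.submatrix_mul_equiv,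
    h.levelMatrix_mul_conjTranspose, Matrix.submatrix_one_equiv]

theorem conjTranspose_mul_genMatrix (h : IsVacuumIsometry Φ) :
    (genMatrix Φ).conjTranspose * genMatrix Φ = 1 := by
  rw [genMatrix, Matrix.conjTranspose_submatrix, Matrix.submatrix_mul_equiv,
    h.conjTranspose_mul_levelMatrix, Matrix.submatrix_one_equiv]

theorem genMatrix_symm (h : IsVacuumIsometry Φ) :
    genMatrix Φ.symm = (genMatrix Φ).conjTranspose := by
  rw [genMatrix, genMatrix, Matrix.conjTranspose_submatrix, h.levelMatrix_symm]

theorem map_shiftA_gen (h : IsVacuumIsometry Φ) (g : Gen n) :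
    Φ (θ.shiftA (θ.gen g)) =
      ∑ j, ∑ q, genMatrix Φ g ⟨j, q⟩ • τ.shiftA (τ.gen ⟨j, q⟩) := by
  have := h.map_shiftA (θ.genEquiv g)
  rwa [sum_level_one] at this

theorem pullback_axisChar_gen (h : IsVacuumIsometry Φ) (j : Fin s) (z : Fin (m j) → ℂ)
    (g : Gen n) :
    h.pullback (τ.axisChar j z) (θ.gen g) = ∑ q, genMatrix Φ g ⟨j, q⟩ * z q := by
  rw [← coe_genEquiv, h.pullback_apply, Matrix.mulVec, dotProduct, sum_level_one,
    Finset.sum_eq_single j]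
  · simp [genMatrix]
  · rintro i - hi
    simp [axisChar_gen_of_ne _ hi]
  · simp

theorem exists_color_of_unit (h : IsVacuumIsometry Φ) (j : Fin s) (z : Fin (m j) → ℂ)
    (hz : ∑ q, ‖z q‖ ^ 2 = 1) :
    ∃ i, ∀ i', i' ≠ i → ∀ p, ∑ q, genMatrix Φ ⟨i', p⟩ ⟨j, q⟩ * z q = 0 := by
  have hk : ∀ k, 1 ≤ ∑ w : θ.Level k, ‖h.pullback (τ.axisChar j z) w‖ ^ 2 := fun k => by
    rw [h.sum_norm_sq_pullback]
    exact τ.one_le_sum_axisChar j z hz k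
  obtain ⟨i, hi⟩ := θ.exists_one_le_sum_color _ hk
  -- In degree one the total is `∑ ‖z q‖² = 1`, and colour `i` already accounts for at least one.
  have h1 := h.sum_norm_sq_pullback (τ.axisChar j z) 1
  rw [sum_level_one, sum_level_one, Finset.sum_eq_single (s := Finset.univ (α := Fin s)) j] at h1
  · simp only [coe_genEquiv, axisChar_gen_self, hz] at h1
    refine ⟨i, fun i' hi' p => ?_⟩
    rw [← Finset.add_sum_erase _ _ (Finset.mem_univ i)] at h1
    have h2 : ∑ x ∈ Finset.univ.erase i,
        ∑ p, ‖h.pullback (τ.axisChar j z) (θ.gen ⟨x, p⟩)‖ ^ 2 = 0 :=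
      le_antisymm (by linarith) (by positivity)
    rw [Finset.sum_eq_zero_iff_of_nonneg fun _ _ => by positivity] at h2
    have h3 := h2 i' (by simp [hi'])
    rw [Finset.sum_eq_zero_iff_of_nonneg fun _ _ => by positivity] at h3
    have h4 := h3 p (Finset.mem_univ _)
    rw [← h.pullback_axisChar_gen]
    simpa using h4
  · rintro i - hi
    simp [axisChar_gen_of_ne _ hi]
  · simp

theorem exists_color_of_ne_zero (h : IsVacuumIsometry Φ) (j : Fin s) (z : Fin (m j) → ℂ)
    (hz : z ≠ 0) : ∃ i, ∀ i', i' ≠ i → ∀ p, ∑ q, genMatrix Φ ⟨i', p⟩ ⟨j, q⟩ * z q = 0 := by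
  set N := ∑ q, ‖z q‖ ^ 2 with hN
  have hN0 : 0 < N := by
    refine lt_of_le_of_ne (by positivity) fun e => hz ?_
    rw [hN, eq_comm, Finset.sum_eq_zero_iff_of_nonneg fun _ _ => by positivity] at e
    funext q
    simpa using e q (Finset.mem_univ _)
  have hs : ((Real.sqrt N : ℝ) : ℂ) ≠ 0 := by exact_mod_cast (Real.sqrt_pos.2 hN0).ne'
  obtain ⟨i, hi⟩ := h.exists_color_of_unit j (fun q => z q * ((Real.sqrt N : ℝ) : ℂ)⁻¹) (by
    simp only [norm_mul, mul_pow, ← Finset.sum_mul, ← hN, norm_inv, Complex.norm_real,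
      Real.norm_eq_abs, inv_pow, sq_abs, Real.sq_sqrt hN0.le]
    exact mul_inv_cancel₀ hN0.ne')
  refine ⟨i, fun i' hi' p => ?_⟩
  have := hi i' hi' p
  simp only [← mul_assoc, ← Finset.sum_mul] at this
  exact (mul_eq_zero.1 this).resolve_right (inv_ne_zero hs)

/-- The generators of one colour of `τ` correspond to generators of a single colour of `θ`. -/
theorem exists_color (h : IsVacuumIsometry Φ) {j : Fin s} (hj : 0 < m j) :
    ∃ i, ∀ i', i' ≠ i → ∀ p q, genMatrix Φ ⟨i', p⟩ ⟨j, q⟩ = 0 := by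
  let P : Fin r → Subspace ℂ (Fin (m j) → ℂ) := fun i =>
    ⨅ (i' : Fin r) (_ : i' ≠ i) (p : Fin (n i')),
      LinearMap.ker (Fintype.linearCombination ℂ fun q => genMatrix Φ ⟨i', p⟩ ⟨j, q⟩)
  have hP : ∀ i z, z ∈ P i ↔
      ∀ i', i' ≠ i → ∀ p, ∑ q, genMatrix Φ ⟨i', p⟩ ⟨j, q⟩ * z q = 0 := by
    intro i z
    simp [P, Submodule.mem_iInf, Fintype.linearCombination_apply, mul_comm]
  have hcov : ⋃ i, (P i : Set (Fin (m j) → ℂ)) = Set.univ := by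
    refine Set.eq_univ_of_forall fun z => Set.mem_iUnion.2 ?_
    simp only [SetLike.mem_coe]
    by_cases hz : z = 0
    -- Zero lies in every `P i`; the nonzero vector only serves to show that some colour `i` exists.
    · obtain ⟨i, -⟩ := h.exists_color_of_ne_zero j (Pi.single ⟨0, hj⟩ 1) (by simp)
      exact ⟨i, hz ▸ zero_mem _⟩
    · obtain ⟨i, hi⟩ := h.exists_color_of_ne_zero j z hz
      exact ⟨i, (hP i z).2 hi⟩
  obtain ⟨i, hi⟩ := Subspace.exists_eq_top_of_iUnion_eq_univ hcov
  refine ⟨i, fun i' hi' p q => ?_⟩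
  have := (hP i (Pi.single q 1)).1 (hi ▸ Submodule.mem_top) i' hi' p
  simpa [Pi.single_apply] using this

/-- The bijection between the colours. -/
theorem exists_colorEquiv (h : IsVacuumIsometry Φ) (hn : ∀ i, 0 < n i) (hm : ∀ j, 0 < m j) :
    ∃ σ : Fin r ≃ Fin s, ∀ i j p q, j ≠ σ i → genMatrix Φ ⟨i, p⟩ ⟨j, q⟩ = 0 := by
  choose κ hκ using fun j => h.exists_color (hm j)
  choose σ hσ using fun i => h.symm.exists_color (hn i)
  simp only [h.genMatrix_symm, Matrix.conjTranspose_apply, star_eq_zero] at hσ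
  -- Otherwise the two vanishing statements together kill a whole row of a unitary matrix.
  have h1 : ∀ i, κ (σ i) = i := by
    intro i
    by_contra hne
    have h1 := congrFun (congrFun h.genMatrix_mul_conjTranspose ⟨i, ⟨0, hn i⟩⟩) ⟨i, ⟨0, hn i⟩⟩
    rw [Matrix.one_apply_eq, Matrix.mul_apply, Finset.sum_eq_zero] at h1
    · exact zero_ne_one h1
    · rintro ⟨j, q⟩ -
      by_cases hj : j = σ i
      · subst hj
        rw [hκ _ i (Ne.symm hne), zero_mul]
      · rw [hσ i j hj, zero_mul]
  have h2 : ∀ j, σ (κ j) = j := by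
    intro j
    by_contra hne
    have h1 := congrFun (congrFun h.conjTranspose_mul_genMatrix ⟨j, ⟨0, hm j⟩⟩) ⟨j, ⟨0, hm j⟩⟩
    rw [Matrix.one_apply_eq, Matrix.mul_apply, Finset.sum_eq_zero] at h1
    · exact zero_ne_one h1
    · rintro ⟨i, p⟩ -
      by_cases hi : i = κ j
      · subst hi
        rw [hσ _ j (Ne.symm hne), mul_zero]
      · rw [hκ j i hi, mul_zero]
  exact ⟨⟨σ, κ, h1, h2⟩, fun i j p q hj => hσ i j hj q p⟩

end IsVacuumIsometry

theorem MatFamily.IsUnitary.card_eq {σ : Fin r ≃ Fin s} {A : MatFamily n m σ} (hA : A.IsUnitary)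
    (i : Fin r) : n i = m (σ i) := by
  have h1 := Matrix.trace_mul_comm (A i) (A i).conjTranspose
  rw [(hA i).1, (hA i).2, Matrix.trace_one, Matrix.trace_one] at h1
  simpa using h1

/-- The Fourier coefficients of the product of the images of two generators. -/
theorem vac_genImage_mul_genImage {σ : Fin r ≃ Fin s} (A : MatFamily n m σ) {i j : Fin r}
    (p : Fin (n i)) (q : Fin (n j)) (k : Fin (m (σ i))) (l : Fin (m (σ j))) :
    τ.vac (genImage τ σ A ⟨i, p⟩ * genImage τ σ A ⟨j, q⟩)
      (τ.gen ⟨σ i, k⟩ * τ.gen ⟨σ j, l⟩) = A i p k * A j q l := by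
  have hinj : ∀ x y, τ.gen ⟨σ i, k⟩ * τ.gen ⟨σ j, l⟩ = τ.gen ⟨σ i, x⟩ * τ.gen ⟨σ j, y⟩ ↔
      k = x ∧ l = y := fun x y => by
    rw [(τ.gen_mul_gen_injective (σ i) (σ j)).eq_iff (a := (k, l)) (b := (x, y)), Prod.mk.injEq]
  simp only [genImage, Finset.sum_mul_sum, smul_mul_smul_comm, ← shiftA_mul, map_sum, map_smul,
    vac_shiftA, lp.coeFn_sum, Finset.sum_apply, lp.coeFn_smul, Pi.smul_apply, smul_eq_mul,
    xi_apply, hinj]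
  rw [Finset.sum_eq_single k, Finset.sum_eq_single l]
  · simp
  · rintro y - hy
    simp [hy.symm]
  · simp
  · rintro x - hx
    simp [hx.symm]
  · simp

theorem intertwines_of_map_gen {σ : Fin r ≃ Fin s} {A : MatFamily n m σ} (hA : A.IsUnitary)
    (Φ : θ.toeplitz →ₐ[ℂ] τ.toeplitz)
    (hΦ : ∀ g : Gen n, Φ (θ.shiftA (θ.gen g)) = genImage τ σ A g) : Intertwines θ τ σ A := by
  intro i j hij
  have hne : i ≠ j := hij.ne
  have hne' : σ i ≠ σ j := fun e => hne (σ.injective e)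
  -- Both sides are the coefficient of the one element `e_{σ(i)k} e_{σ(j)l}` in the image of `e_{ip}
  -- e_{jq}`; on the right both products are rewritten with the other colour first.
  have key : ∀ p q k l, A i p k * A j q l =
      A i (θ.relPerm i j (p, q)).1 (τ.relPerm (σ i) (σ j) (k, l)).1 *
        A j (θ.relPerm i j (p, q)).2 (τ.relPerm (σ i) (σ j) (k, l)).2 := by
    intro p q k l
    rw [← vac_genImage_mul_genImage (τ := τ) A, ← hΦ, ← hΦ, ← map_mul, ← shiftA_mul,
      θ.gen_mul_gen hne, τ.gen_mul_gen hne', shiftA_mul, map_mul, hΦ, hΦ,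
      vac_genImage_mul_genImage A, mul_comm]
  have hK : (A i ⊗ₖ A j) * (A i ⊗ₖ A j).conjTranspose = 1 := by
    rw [Matrix.conjTranspose_kronecker, ← Matrix.mul_kronecker_mul, (hA i).1, (hA j).1,
      Matrix.one_kronecker_one]
  have hcomm : (θ.relPerm i j).permMatrix ℂ * (A i ⊗ₖ A j) =
      (A i ⊗ₖ A j) * (τ.relPerm (σ i) (σ j)).permMatrix ℂ := by
    rw [Equiv.Perm.permMatrix, Equiv.Perm.permMatrix, PEquiv.toMatrix_toPEquiv_mul,
      PEquiv.mul_toMatrix_toPEquiv]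
    ext ⟨p, q⟩ y
    obtain ⟨⟨k, l⟩, rfl⟩ := (τ.relPerm (σ i) (σ j)).surjective y
    simp only [Matrix.submatrix_apply, id, Equiv.symm_apply_apply, Matrix.kroneckerMap_apply]
    exact (key p q k l).symm
  rw [← hcomm, Matrix.mul_assoc, hK, Matrix.mul_one]

end Colors

end HigherRank

end

/-! ### The main theorem -/

theorem theorem7p2 {r s : ℕ} {n : Fin r → ℕ} {m : Fin s → ℕ}
    (hn : ∀ i, 0 < n i) (hm : ∀ i, 0 < m i)
    (θ : PermSet n) (τ : PermSet m) [IsCancelMul θ.Semi] [IsCancelMul τ.Semi]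
    (Φ : θ.toeplitz ≃ₐ[ℂ] τ.toeplitz) (hΦ : Isometry Φ)
    (hI : Φ '' θ.zeroConst = τ.zeroConst) :
    ∃ σ : Fin r ≃ Fin s, (∀ i, n i = m (σ i)) ∧
      ∃ A : MatFamily n m σ, A.IsUnitary ∧
        -- product unitary equivalence of the permutation sets
        Intertwines θ τ σ A ∧
        -- multi-graded
        (∀ g : Gen n, Φ (θ.shiftA (θ.gen g)) = genImage τ σ A g) ∧
        -- unitarily implemented
        ∃ U : θ.Fock ≃ₗᵢ[ℂ] τ.Fock, IsTensorUnitary θ τ σ A U ∧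
          ∀ (X : θ.toeplitz) (v : τ.Fock),
            (Φ X : τ.Fock →L[ℂ] τ.Fock) v =
              U ((X : θ.Fock →L[ℂ] θ.Fock) (U.symm v)) := by
  have h := IsVacuumIsometry.of_isometry hΦ hI
  obtain ⟨σ, hσ⟩ := h.exists_colorEquiv hn hm
  let G := IsVacuumIsometry.genMatrix Φ
  -- The other blocks of `G` vanish, so these blocks inherit unitarity from `G`.
  let A : MatFamily n m σ := fun i p q => G ⟨i, p⟩ ⟨σ i, q⟩
  have hA : A.IsUnitary := by
    refine fun i => ⟨?_, ?_⟩
    · ext p p'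
      have h1 := congrFun (congrFun h.genMatrix_mul_conjTranspose ⟨i, p⟩) ⟨i, p'⟩
      rw [Matrix.mul_apply, Fintype.sum_sigma, Finset.sum_eq_single (σ i)] at h1
      · rw [Matrix.mul_apply]
        refine h1.trans ?_
        simp [Matrix.one_apply]
      · rintro j - hj
        exact Finset.sum_eq_zero fun q _ => by rw [hσ i j p q hj, zero_mul]
      · simp
    · ext q q'
      have h1 := congrFun (congrFun h.conjTranspose_mul_genMatrix ⟨σ i, q⟩) ⟨σ i, q'⟩
      rw [Matrix.mul_apply, Fintype.sum_sigma, Finset.sum_eq_single i] at h1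
      · rw [Matrix.mul_apply]
        refine h1.trans ?_
        simp [Matrix.one_apply]
      · rintro i' - hi'
        exact Finset.sum_eq_zero fun p _ => by
          rw [hσ i' (σ i) p q' fun e => hi' (σ.injective e).symm, mul_zero]
      · simp
  have hgen : ∀ g : Gen n, Φ (θ.shiftA (θ.gen g)) = genImage τ σ A g := by
    rintro ⟨i, p⟩
    rw [h.map_shiftA_gen, Finset.sum_eq_single (σ i)]
    · rfl
    · rintro j - hj
      exact Finset.sum_eq_zero fun q _ => by rw [hσ i j p q hj, zero_smul]
    · simp
  refine ⟨σ, hA.card_eq, A, hA, intertwines_of_map_gen hA Φ.toAlgHom hgen, hgen, h.unitary, ?_,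
    h.map_apply⟩
  intro l
  -- Since `U ξ_w = Φ(L_w) ξ_1`, the tensor form of `U` is the multiplicativity of `Φ` along a word.
  rw [h.unitary_xi, PermSet.shiftA_prod, map_list_prod, List.map_map, List.map_map,
    PermSet.vac_apply]
  congr 4
  exact funext hgen
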